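/- An operator algebra $\mathcal A$ is a norm closed subalgebra of $B(H)$, for a complex Hilbert space $H$, which possesses a contractive (two-sided) approximate identity. Let $G$ be a discrete abelian group and let $\alpha$ be a homomorphism from $G$ into the group of completely isometric algebra automorphisms of $\mathcal A$. Let $C^*_{\max}(\mathcal A)$ be the maximal (universal) $C^*$-algebra generated by a completely isometric copy of $\mathcal A$, i.e. the one to which every completely contractive homomorphism of $\mathcal A$ into a $C^*$-algebra extends as a $*$-homomorphism. The action $\alpha$ extends uniquely to an action, again denoted by $\alpha$, of $G$ on $C^*_{\max}(\mathcal A)$ by $*$-automorphisms. Let $C^*_{\max}(\mathcal A)\rtimes_\alpha G$ be the full crossed product $C^*$-algebra, i.e. the completion of the algebra $C_c(G, C^*_{\max}(\mathcal A))$ of finitely supported functions in the norm $\|f\|=\sup_{(\pi,u)}\bigl\|\sum_{s\in G}\pi(f(s))u(s)\bigr\|$, the supremum being over all covariant representations. The crossed product $\mathcal A\rtimes_\alpha G$ is the norm closed subalgebra of $C^*_{\max}(\mathcal A)\rtimes_\alpha G$ generated by $C_c(G,\mathcal A)$. The Jacobson radical of a (not necessarily unital) ring $R$ is the intersection of all maximal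 regular right ideals of $R$, where a right ideal $I$ is regular if there is $e\in R$ with $ex-x\in I$ for all $x\in R$ (the intersection is $R$ if there are none); $R$ is semisimple if its Jacobson radical is $\{0\}$. Theorem. If $\mathcal A$ is semisimple, then $\mathcal A\rtimes_\alpha G$ is semisimple. -/

import Mathlib

open scoped ENNReal

universe u v w

noncomputable section

namespace OpAlg

/-! ### The Jacobson radical of a (not necessarily unital) ring -/

section Radical

variable {R : Type*} [NonUnitalRing R]

/-- An additive subgroup that absorbs multiplication on the right. -/
def IsRightIdeal (I : AddSubgroup R) : Prop :=
  ∀ x ∈ I, ∀ r : R, x * r ∈ I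

/-- A right ideal `I` is regular (modular) if some `e` is a left unit modulo `I`. -/
def IsRegularRightIdeal (I : AddSubgroup R) : Prop :=
  IsRightIdeal I ∧ ∃ e : R, ∀ x : R, e * x - x ∈ I

/-- A maximal regular right ideal: a regular right ideal which is maximal among the proper
right ideals. -/
def IsMaximalRegularRightIdeal (I : AddSubgroup R) : Prop :=
  IsRegularRightIdeal I ∧ I ≠ ⊤ ∧ ∀ J : AddSubgroup R, IsRightIdeal J → I < J → J = ⊤

variable (R) in
/-- The Jacobson radical: the intersection of all maximal regular right ideals
(all of `R` if there are none). -/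
def jacobsonRadical : Set R :=
  {x | ∀ I : AddSubgroup R, IsMaximalRegularRightIdeal I → x ∈ I}

variable (R) in
/-- A ring is semisimple if its Jacobson radical is zero. -/
def IsSemisimple : Prop := jacobsonRadical R = {0}

end Radical

/-! ### Operator algebras, complete contractions and dynamical systems -/

section OperatorAlgebra

variable {H : Type u} [NormedAddCommGroup H] [InnerProductSpace ℂ H] [CompleteSpace H]

/-- An (approximately unital) operator algebra on the Hilbert space `H`: a norm closed subalgebra
of `B(H)` which possesses a contractive approximate identity. -/
structure IsOperatorAlgebra (A : NonUnitalSubalgebra ℂ (H →L[ℂ] H)) : Prop where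
  isClosed : IsClosed (A : Set (H →L[ℂ] H))
  exists_approxUnit : ∃ l : Filter A, l.IsApproximateUnit ∧ ∀ᶠ e in l, ‖e‖ ≤ 1

/-- The norm of a matrix over the operator algebra `A ⊆ B(H)`: its norm in the C⋆-algebra
`M_n(B(H))`, i.e. its operator norm on `H ⊕ ⋯ ⊕ H`. -/
def matrixNorm {A : NonUnitalSubalgebra ℂ (H →L[ℂ] H)} {n : ℕ}
    (M : Matrix (Fin n) (Fin n) A) : ℝ :=
  ‖CStarMatrix.ofMatrix (M.map (fun a => (a : H →L[ℂ] H)))‖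

/-- A homomorphism `π : A → B(K)` is completely contractive if all its amplifications
`M_n(A) → M_n(B(K))` are contractive. -/
def IsCompletelyContractive {A : NonUnitalSubalgebra ℂ (H →L[ℂ] H)}
    {K : Type w} [NormedAddCommGroup K] [InnerProductSpace ℂ K] [CompleteSpace K]
    (π : A →ₙₐ[ℂ] (K →L[ℂ] K)) : Prop :=
  ∀ (n : ℕ) (M : Matrix (Fin n) (Fin n) A), ‖CStarMatrix.ofMatrix (M.map π)‖ ≤ matrixNorm M

/-- The action of a (discrete) group `G` on the operator algebra `A` by completely isometric
automorphisms. (Each `α s` is bijective, with inverse `α s⁻¹`, by the first two laws.) -/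
structure Action (G : Type v) [Group G] (A : NonUnitalSubalgebra ℂ (H →L[ℂ] H)) where
  toFun : G → (A →ₙₐ[ℂ] A)
  map_one : ∀ a : A, toFun 1 a = a
  map_mul : ∀ (s t : G) (a : A), toFun (s * t) a = toFun s (toFun t a)
  completelyIsometric : ∀ (s : G) (n : ℕ) (M : Matrix (Fin n) (Fin n) A),
    matrixNorm (M.map (toFun s)) = matrixNorm M

end OperatorAlgebra

/-! ### The maximal (universal) C⋆-cover of an operator algebra -/

section Max

variable {H : Type u} [NormedAddCommGroup H] [InnerProductSpace ℂ H] [CompleteSpace H]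

/-- A completely contractive homomorphism of `A` into some `B(K)`. Every completely contractive
homomorphism on a Hilbert space of any size is a direct sum of ones acting on Hilbert spaces
in the universe of `A`, so nothing is lost by the restriction on the universe of `K`.
Degenerate homomorphisms are allowed: since `A` has a contractive approximate identity, each of
them is the direct sum of a non-degenerate one and a zero one. -/
structure Rep (A : NonUnitalSubalgebra ℂ (H →L[ℂ] H)) where
  K : Type u
  [normed : NormedAddCommGroup K]
  [inner : InnerProductSpace ℂ K]
  [complete : CompleteSpace K]
  π : A →ₙₐ[ℂ] (K →L[ℂ] K)
  contractive : IsCompletelyContractive π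

attribute [instance] Rep.normed Rep.inner Rep.complete

variable (A : NonUnitalSubalgebra ℂ (H →L[ℂ] H))

/-- The `ℓ^∞`-product of the algebras `B(K)` over all completely contractive homomorphisms
`A → B(K)`. -/
def RepProduct : Type (u + 1) := lp (fun r : Rep A => r.K →L[ℂ] r.K) ∞

instance : NonUnitalCStarAlgebra (RepProduct A) :=
  inferInstanceAs (NonUnitalCStarAlgebra (lp (fun r : Rep A => r.K →L[ℂ] r.K) ∞))

variable {A}

/-- The coordinate of an element of the product at the homomorphism `r`. -/
def RepProduct.coord (x : RepProduct A) (r : Rep A) : r.K →L[ℂ] r.K :=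
  Subtype.val (p := (· ∈ lp (fun r : Rep A => r.K →L[ℂ] r.K) ∞)) x r

/-- The embedding of `D` into the `1 × 1` matrices over `D`. -/
def oneByOne (D : Type w) [NonUnitalCStarAlgebra D] [PartialOrder D] [StarOrderedRing D] :
    D →⋆ₙₐ[ℂ] CStarMatrix (Fin 1) (Fin 1) D where
  toFun d := CStarMatrix.ofMatrix (Matrix.of fun _ _ => d)
  map_smul' _ _ := rfl
  map_zero' := rfl
  map_add' _ _ := rfl
  map_mul' x y := by ext i j; simp [CStarMatrix.mul_apply]
  map_star' _ := rfl

lemma Rep.norm_le (r : Rep A) (a : A) : ‖r.π a‖ ≤ ‖a‖ := by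
  have h := r.contractive 1 (Matrix.of fun _ _ => a)
  have h1 := CStarMatrix.norm_entry_le_norm
    (M := CStarMatrix.ofMatrix ((Matrix.of fun _ _ => a : Matrix (Fin 1) (Fin 1) A).map r.π))
    (i := 0) (j := 0)
  have h2 := NonUnitalStarAlgHom.norm_apply_le (oneByOne (H →L[ℂ] H)) (a : H →L[ℂ] H)
  exact (h1.trans h).trans h2

/-- The direct sum of all completely contractive homomorphisms of `A`. -/
def toRepProduct (a : A) : RepProduct A :=
  (⟨fun r => r.π a, memℓp_infty ⟨‖a‖, by rintro _ ⟨r, rfl⟩; exact r.norm_le a⟩⟩ :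
    lp (fun r : Rep A => r.K →L[ℂ] r.K) ∞)

variable (A) in
/-- The C⋆-subalgebra generated by the image of `A` under the direct sum of all its completely
contractive homomorphisms. -/
def maxSubalgebra : NonUnitalStarSubalgebra ℂ (RepProduct A) :=
  (NonUnitalStarAlgebra.adjoin ℂ (Set.range (toRepProduct (A := A)))).topologicalClosure

instance : IsClosed (maxSubalgebra A : Set (RepProduct A)) :=
  NonUnitalStarSubalgebra.isClosed_topologicalClosure _

variable (A) in
/-- The maximal C⋆-cover `C⋆_max(A)` as a C⋆-algebra. -/
def CStarMax : Type (u + 1) := maxSubalgebra A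

instance : NonUnitalCStarAlgebra (CStarMax A) :=
  inferInstanceAs (NonUnitalCStarAlgebra (maxSubalgebra A))

/-- The canonical completely isometric embedding `j : A → C⋆_max(A)`. -/
def toCStarMax (a : A) : CStarMax A :=
  (⟨toRepProduct a, NonUnitalStarSubalgebra.le_topologicalClosure _
    (NonUnitalStarAlgebra.subset_adjoin ℂ _ ⟨a, rfl⟩)⟩ : maxSubalgebra A)

variable {G : Type v} [Group G]

/-- The completely contractive homomorphism `π ∘ α_s`. -/
def Rep.twist (α : Action G A) (s : G) (r : Rep A) : Rep A where
  K := r.K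
  π := r.π.comp (α.toFun s)
  contractive := fun n M => by
    rw [← α.completelyIsometric s n M]
    exact r.contractive n (M.map (α.toFun s))

/-- The automorphism of the product that permutes the coordinates by `π ↦ π ∘ α_s`. -/
def twistHom (α : Action G A) (s : G) : RepProduct A →⋆ₙₐ[ℂ] RepProduct A where
  toFun (x : lp (fun r : Rep A => r.K →L[ℂ] r.K) ∞) :=
    (⟨fun r => x (r.twist α s), memℓp_infty ⟨‖x‖, by
      rintro _ ⟨r, rfl⟩
      exact lp.norm_apply_le_norm ENNReal.top_ne_zero x (r.twist α s)⟩⟩ :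
      lp (fun r : Rep A => r.K →L[ℂ] r.K) ∞)
  map_smul' _ _ := rfl
  map_zero' := rfl
  map_add' _ _ := rfl
  map_mul' _ _ := rfl
  map_star' _ := rfl

lemma twistHom_toRepProduct (α : Action G A) (s : G) (a : A) :
    twistHom α s (toRepProduct a) = toRepProduct (α.toFun s a) := rfl

lemma twistHom_mem (α : Action G A) (s : G) {x : RepProduct A} (hx : x ∈ maxSubalgebra A) :
    twistHom α s x ∈ maxSubalgebra A := by
  have hcont : Continuous (twistHom α s) :=
    AddMonoidHomClass.continuous_of_bound (twistHom α s) 1 fun x => by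
      simpa using NonUnitalStarAlgHom.norm_apply_le (twistHom α s) x
  have hle : maxSubalgebra A ≤ (maxSubalgebra A).comap (twistHom α s) := by
    refine NonUnitalStarSubalgebra.topologicalClosure_minimal _
      (NonUnitalStarAlgebra.adjoin_le ?_)
      ((inferInstance : IsClosed (maxSubalgebra A : Set (RepProduct A))).preimage hcont)
    rintro _ ⟨a, rfl⟩
    exact (NonUnitalStarSubalgebra.le_topologicalClosure _
      (NonUnitalStarAlgebra.subset_adjoin ℂ _ ⟨α.toFun s a, rfl⟩))
  exact hle hx

lemma Rep.mk_congr {K : Type u} [NormedAddCommGroup K] [InnerProductSpace ℂ K] [CompleteSpace K]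
    {π π' : A →ₙₐ[ℂ] (K →L[ℂ] K)} (h : π = π') (hc : IsCompletelyContractive π)
    (hc' : IsCompletelyContractive π') : Rep.mk K π hc = Rep.mk K π' hc' := by
  subst h; rfl

lemma Rep.twist_one (α : Action G A) (r : Rep A) : r.twist α 1 = r :=
  Rep.mk_congr (π := r.π.comp (α.toFun 1))
    (NonUnitalAlgHom.ext fun a => congrArg r.π (α.map_one a)) _ _

lemma Rep.twist_twist (α : Action G A) (s t : G) (r : Rep A) :
    (r.twist α s).twist α t = r.twist α (s * t) :=
  Rep.mk_congr (π := (r.π.comp (α.toFun s)).comp (α.toFun t)) (π' := r.π.comp (α.toFun (s * t)))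
    (NonUnitalAlgHom.ext fun a => congrArg r.π (α.map_mul s t a).symm) _ _

lemma twistHom_one (α : Action G A) (x : RepProduct A) : twistHom α 1 x = x :=
  lp.ext (E := fun r : Rep A => r.K →L[ℂ] r.K) <| funext fun r =>
    eq_of_heq (congr_arg_heq
      (fun r => RepProduct.coord x r) (r.twist_one α))

lemma twistHom_mul (α : Action G A) (s t : G) (x : RepProduct A) :
    twistHom α (s * t) x = twistHom α s (twistHom α t x) :=
  lp.ext (E := fun r : Rep A => r.K →L[ℂ] r.K) <| funext fun r =>
    eq_of_heq (congr_arg_heq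
      (fun r => RepProduct.coord x r) (r.twist_twist α s t).symm)

/-- The automorphism of `C⋆_max(A)` extending the automorphism `α_s` of `A`. -/
def maxAut (α : Action G A) (s : G) : CStarMax A ≃⋆ₐ[ℂ] CStarMax A where
  toFun (x : maxSubalgebra A) := (⟨twistHom α s x, twistHom_mem α s x.2⟩ : maxSubalgebra A)
  invFun (x : maxSubalgebra A) := (⟨twistHom α s⁻¹ x, twistHom_mem α s⁻¹ x.2⟩ : maxSubalgebra A)
  left_inv (x : maxSubalgebra A) := Subtype.ext <| by
    have h := twistHom_mul α s⁻¹ s x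
    rw [inv_mul_cancel, twistHom_one] at h
    exact h.symm
  right_inv (x : maxSubalgebra A) := Subtype.ext <| by
    have h := twistHom_mul α s s⁻¹ x
    rw [mul_inv_cancel, twistHom_one] at h
    exact h.symm
  map_mul' (x y : maxSubalgebra A) := Subtype.ext (map_mul (twistHom α s) (x : RepProduct A) y)
  map_add' (x y : maxSubalgebra A) := Subtype.ext (map_add (twistHom α s) (x : RepProduct A) y)
  map_star' (x : maxSubalgebra A) := Subtype.ext (map_star (twistHom α s) (x : RepProduct A))
  map_smul' c (x : maxSubalgebra A) :=
    Subtype.ext (map_smul (twistHom α s) c (x : RepProduct A))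

/-- The action of `G` on `C⋆_max(A)` extending the action on `A`. -/
def maxAction (α : Action G A) : G →* (CStarMax A ≃⋆ₐ[ℂ] CStarMax A) where
  toFun s := maxAut α s
  map_one' := StarAlgEquiv.ext fun (x : maxSubalgebra A) => Subtype.ext (twistHom_one α x)
  map_mul' s t := StarAlgEquiv.ext fun (x : maxSubalgebra A) =>
    Subtype.ext (twistHom_mul α s t x)

lemma maxAction_toCStarMax (α : Action G A) (s : G) (a : A) :
    maxAction α s (toCStarMax a) = toCStarMax (α.toFun s a) := rfl

end Max

/-! ### Crossed products by discrete groups -/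

section CrossedProduct

variable {G : Type v} [Group G] {C : Type w} [NonUnitalCStarAlgebra C]

/-- A (possibly degenerate) covariant representation of the C⋆-dynamical system `(C, G, β)`,
`G` discrete. The universe of `K` is large enough for all cyclic representations. A degenerate one
is the direct sum of its restriction to the closed span of `π(C)K`, which reduces `u`, and one
with `π = 0`; so allowing degenerate ones does not change the universal norm. -/
structure CovariantRep (β : G →* (C ≃⋆ₐ[ℂ] C)) where
  K : Type (max v w)
  [normed : NormedAddCommGroup K]
  [inner : InnerProductSpace ℂ K]
  [complete : CompleteSpace K]
  π : C →⋆ₙₐ[ℂ] (K →L[ℂ] K)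
  u : G →* unitary (K →L[ℂ] K)
  covariant : ∀ (s : G) (c : C), (u s : K →L[ℂ] K) * π c = π (β s c) * (u s : K →L[ℂ] K)

attribute [instance] CovariantRep.normed CovariantRep.inner CovariantRep.complete

variable (β : G →* (C ≃⋆ₐ[ℂ] C))

/-- The `ℓ^∞`-product of the algebras `B(K)` over all covariant representations. -/
def CovariantProduct : Type (max v w + 1) :=
  lp (fun r : CovariantRep β => r.K →L[ℂ] r.K) ∞

instance : NonUnitalCStarAlgebra (CovariantProduct β) :=
  inferInstanceAs (NonUnitalCStarAlgebra (lp (fun r : CovariantRep β => r.K →L[ℂ] r.K) ∞))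

variable {β}

/-- The integrated form `π ⋊ u` on `C_c(G, C)`, i.e. `f ↦ ∑ s, π (f s) u(s)`. -/
def CovariantRep.integrated (r : CovariantRep β) (f : G →₀ C) : r.K →L[ℂ] r.K :=
  f.sum fun s c => r.π c * (r.u s : r.K →L[ℂ] r.K)

lemma CovariantRep.norm_integrated_le (r : CovariantRep β) (f : G →₀ C) :
    ‖r.integrated f‖ ≤ f.sum fun _ c => ‖c‖ := by
  refine norm_sum_le_of_le _ fun s _ => ?_
  calc ‖r.π (f s) * (r.u s : r.K →L[ℂ] r.K)‖ = ‖r.π (f s)‖ :=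
        CStarRing.norm_mul_coe_unitary _ _
    _ ≤ ‖f s‖ := NonUnitalStarAlgHom.norm_apply_le r.π (f s)

variable (β) in
/-- The universal integrated form: the direct sum of all `π ⋊ u`. The norm of the image of `f` is
the supremum of `‖(π ⋊ u) f‖` over all covariant representations. -/
def universalIntegrated (f : G →₀ C) : CovariantProduct β :=
  (⟨fun r => r.integrated f, memℓp_infty ⟨f.sum fun _ c => ‖c‖, by
    rintro _ ⟨r, rfl⟩; exact r.norm_integrated_le f⟩⟩ :
    lp (fun r : CovariantRep β => r.K →L[ℂ] r.K) ∞)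

variable (β) in
/-- The norm closure of (the ⋆-algebra) `C_c(G, C)` in the universal representation. -/
def crossedSubalgebra : NonUnitalStarSubalgebra ℂ (CovariantProduct β) :=
  (NonUnitalStarAlgebra.adjoin ℂ (Set.range (universalIntegrated β))).topologicalClosure

instance : IsClosed (crossedSubalgebra β : Set (CovariantProduct β)) :=
  NonUnitalStarSubalgebra.isClosed_topologicalClosure _

variable (β) in
/-- The full crossed product C⋆-algebra `C ⋊_β G`: the completion of `C_c(G, C)` in the universal
norm, realized in the universal representation. -/
def CStarCrossedProduct : Type (max v w + 1) := crossedSubalgebra β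

instance : NonUnitalCStarAlgebra (CStarCrossedProduct β) :=
  inferInstanceAs (NonUnitalCStarAlgebra (crossedSubalgebra β))

variable (β) in
/-- The canonical map `C_c(G, C) → C ⋊_β G`. -/
def toCStarCrossedProduct (f : G →₀ C) : CStarCrossedProduct β :=
  (⟨universalIntegrated β f, NonUnitalStarSubalgebra.le_topologicalClosure _
    (NonUnitalStarAlgebra.subset_adjoin ℂ _ ⟨f, rfl⟩)⟩ : crossedSubalgebra β)

variable (β) in
/-- The relative crossed product of the subset `B = j(A)` of `C`: the closed subalgebra (not closed
under the involution) of `C ⋊_β G` generated by `C_c(G, j(A))`. -/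
def relativeCrossedProduct (B : Set C) : NonUnitalSubalgebra ℂ (CStarCrossedProduct β) :=
  (NonUnitalAlgebra.adjoin ℂ
    {x | ∃ f : G →₀ C, (∀ s, f s ∈ B) ∧ toCStarCrossedProduct β f = x}).topologicalClosure

variable {H : Type u} [NormedAddCommGroup H] [InnerProductSpace ℂ H] [CompleteSpace H]

/-- The (full) crossed product `A ⋊_α G` of an operator algebra: the relative crossed product with
respect to the cover `C⋆_max(A)` and the canonical extension of the action to it. -/
def crossedProduct {A : NonUnitalSubalgebra ℂ (H →L[ℂ] H)} (α : Action G A) :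
    NonUnitalSubalgebra ℂ (CStarCrossedProduct (maxAction α)) :=
  relativeCrossedProduct (maxAction α) (Set.range (toCStarMax (A := A)))

end CrossedProduct

end OpAlg

end

/-! The dual group of `G` acts on `A ⋊ G` by gauge automorphisms sending `a u_s` to `χ(s) a u_s`;
the proof is Fourier analysis for this action. The Jacobson radical of a Banach algebra is a closed
subspace stable under automorphisms, so averaging `conj χ(s) γ_χ(x)` over the compact dual keeps a
radical element `x` inside the radical. By orthogonality of characters this average is `a_s u_s`,
where `a_s ∈ A` is the Fourier coefficient of `x` at `s` (`spectralProj_eq`,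
`ι_coeff_mem_jacobsonRadical`).

Multiplying `a_s u_s` on the right by `α_{s⁻¹}(b) u_{s⁻¹}` puts `a_s b` in the radical of `A ⋊ G`,
so `a_s b` has a right quasi-inverse `y` there. The coefficient at `1` is a left `A`-module map, so
it carries `y` to a right quasi-inverse of `a_s b` in `A`. This holds for every `b`, hence `a_s`
lies in the radical of `A`, which is zero. An element whose Fourier coefficients all vanish is zero
(`eq_zero_of_coeff_eq_zero`), so `x = 0`.

The argument is run for an abstract `FourierSystem`. For the crossed product, the gauge action comes
from permuting covariant representations, `(π, u) ↦ (π, χu)`, and the coefficients are matrix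
entries of the regular representation on `ℓ²(G, H)`. -/

noncomputable section

namespace OpAlg

/-! ### The Jacobson radical through right quasi-regularity. -/

section RadicalTheory

variable {R : Type*} [NonUnitalRing R]

lemma IsMaximalRegularRightIdeal.not_mem_of_forall {I : AddSubgroup R}
    (hI : IsMaximalRegularRightIdeal I) {e : R} (he : ∀ x : R, e * x - x ∈ I) : e ∉ I := by
  intro h
  refine hI.2.1 (eq_top_iff.2 fun x _ => ?_)
  have := I.sub_mem (hI.1.1 e h x) (he x)
  simpa using this

lemma IsMaximalRegularRightIdeal.eq_top_of_le {I J : AddSubgroup R}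
    (hI : IsMaximalRegularRightIdeal I) (hJ : IsRightIdeal J) (hIJ : I ≤ J) {x : R}
    (hxJ : x ∈ J) (hxI : x ∉ I) : J = ⊤ :=
  hI.2.2 J hJ (lt_of_le_of_ne hIJ fun h => hxI (h ▸ hxJ))

/-- An element annihilated modulo a maximal regular right ideal lies in that ideal. -/
lemma IsMaximalRegularRightIdeal.mem_of_forall_mul_mem {I : AddSubgroup R}
    (hI : IsMaximalRegularRightIdeal I) {c : R} (hc : ∀ r, c * r ∈ I) : c ∈ I := by
  by_contra hcI
  -- The right ideal of all `x` with `xR ⊆ I` contains `I`. If it were everything it would contain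
  -- the left unit `e` modulo `I`, and then `e * x - x ∈ I` would give `x ∈ I` for every `x`.
  let J : AddSubgroup R :=
    { carrier := {x | ∀ r, x * r ∈ I}
      zero_mem' := fun r => by simp [I.zero_mem]
      add_mem' := fun {a b} ha hb r => by rw [add_mul]; exact I.add_mem (ha r) (hb r)
      neg_mem' := fun {a} ha r => by rw [neg_mul]; exact I.neg_mem (ha r) }
  have hJ : J = ⊤ := hI.eq_top_of_le (J := J)
    (fun x hx r s => by rw [mul_assoc]; exact hx _) (fun x hx r => hI.1.1 x hx r) hc hcI
  obtain ⟨e, he⟩ := hI.1.2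
  refine hI.2.1 (eq_top_iff.2 fun x _ => ?_)
  have h1 : e * x ∈ I := (hJ ▸ AddSubgroup.mem_top e : e ∈ J) x
  simpa using I.sub_mem h1 (he x)

lemma mul_mem_jacobsonRadical {x : R} (hx : x ∈ jacobsonRadical R) (r : R) :
    x * r ∈ jacobsonRadical R :=
  fun I hI => hI.1.1 x (hx I hI) r

/-- Elements of the radical are right quasi-regular. -/
lemma exists_quasiInverse_of_mem_jacobsonRadical {x : R} (hx : x ∈ jacobsonRadical R) :
    ∃ z, x * z = x + z := by
  -- The right ideal `(x - 1)R`, for which `x` is a left unit; `x` lies in it exactly when `x` has a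
  -- right quasi-inverse.
  let I₀ : AddSubgroup R := (AddMonoidHom.mulLeft x - AddMonoidHom.id R).range
  have hI₀ : IsRightIdeal I₀ := by
    rintro _ ⟨y, rfl⟩ r
    exact ⟨y * r, by simp [sub_mul, mul_assoc]⟩
  have hmem : ∀ y : R, x * y - y ∈ I₀ := fun y => ⟨y, rfl⟩
  by_cases h : x ∈ I₀
  · obtain ⟨z, hz⟩ := h
    refine ⟨z, ?_⟩
    have hz' : x * z - z = x := hz
    exact sub_eq_iff_eq_add.1 hz'
  · exfalso
    -- A right ideal maximal among those containing `I₀` and omitting `x` is maximal outright: a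
    -- larger one contains `x`, hence `x * y` and `x * y - y`, hence every `y`.
    obtain ⟨M, hM₀, hM⟩ := zorn_le_nonempty₀
      {J : AddSubgroup R | IsRightIdeal J ∧ I₀ ≤ J ∧ x ∉ J} (fun c hc hchain J hJc => by
        have hne : c.Nonempty := ⟨J, hJc⟩
        have hdir : DirectedOn (· ≤ ·) c := hchain.directedOn
        refine ⟨sSup c, ⟨?_, ?_, ?_⟩, fun J hJ => le_sSup hJ⟩
        · intro y hy r
          obtain ⟨K, hK, hyK⟩ := (AddSubgroup.mem_sSup_of_directedOn hne hdir).1 hy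
          exact (AddSubgroup.mem_sSup_of_directedOn hne hdir).2 ⟨K, hK, (hc hK).1 y hyK r⟩
        · exact (hc hJc).2.1.trans (le_sSup hJc)
        · intro hx'
          obtain ⟨K, hK, hxK⟩ := (AddSubgroup.mem_sSup_of_directedOn hne hdir).1 hx'
          exact (hc hK).2.2 hxK) I₀ ⟨hI₀, le_rfl, h⟩
    refine hM.prop.2.2 (hx M ⟨⟨hM.prop.1, x, fun y => hM.prop.2.1 (hmem y)⟩, ?_, ?_⟩)
    · intro htop
      exact hM.prop.2.2 (htop ▸ AddSubgroup.mem_top x)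
    · intro J hJ hlt
      have hxJ : x ∈ J := by
        by_contra hxJ
        exact hlt.not_ge (hM.le_of_ge ⟨hJ, hM.prop.2.1.trans hlt.le, hxJ⟩ hlt.le)
      refine eq_top_iff.2 fun y _ => ?_
      simpa using J.sub_mem (hJ x hxJ y) (hlt.le (hM.prop.2.1 (hmem y)))

/-- If `c` were outside a maximal regular right ideal `I`, then `I + cR` would be everything, so the
left unit modulo `I` would be `e = i + c * y` with `i ∈ I`. A right quasi-inverse `z` of `c * y = e
- i` then gives `e = (e * z - z) - i * z + i ∈ I`, which is impossible. -/
lemma mem_jacobsonRadical_of_forall {c : R} (hc : ∀ r, ∃ z, c * r * z = c * r + z) :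
    c ∈ jacobsonRadical R := by
  intro I hI
  by_contra hcI
  obtain ⟨b, hb⟩ : ∃ b, c * b ∉ I := by
    by_contra! h
    exact hcI (hI.mem_of_forall_mul_mem h)
  let J : AddSubgroup R := I ⊔ (AddMonoidHom.mulLeft c).range
  have hJ : IsRightIdeal J := by
    intro x hx r
    obtain ⟨i, hi, _, ⟨y, rfl⟩, rfl⟩ := AddSubgroup.mem_sup.1 hx
    exact AddSubgroup.mem_sup.2 ⟨i * r, hI.1.1 i hi r, c * (y * r), ⟨y * r, rfl⟩, by
      simp [add_mul, mul_assoc]⟩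
  have htop : J = ⊤ := hI.eq_top_of_le hJ le_sup_left
    (AddSubgroup.mem_sup_right ⟨b, rfl⟩ : c * b ∈ J) hb
  obtain ⟨e, he⟩ := hI.1.2
  obtain ⟨i, hi, _, ⟨y, rfl⟩, hie⟩ := AddSubgroup.mem_sup.1 (htop ▸ AddSubgroup.mem_top e : e ∈ J)
  obtain ⟨z, hz⟩ := hc y
  refine hI.not_mem_of_forall he ?_
  have hcy : c * y = e - i := by rw [← hie]; simp
  rw [hcy] at hz
  have : e = (e * z - z) - i * z + i := by
    have h2 : e * z - i * z = e - i + z := by rw [← sub_mul, hz]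
    calc e = (e - i + z) - z + i := by abel
      _ = _ := by rw [← h2]; abel
  rw [this]
  exact I.add_mem (I.sub_mem (he z) (hI.1.1 i hi z)) hi

lemma mem_jacobsonRadical_iff {c : R} :
    c ∈ jacobsonRadical R ↔ ∀ r, ∃ z, c * r * z = c * r + z :=
  ⟨fun h r => exists_quasiInverse_of_mem_jacobsonRadical (mul_mem_jacobsonRadical h r),
    mem_jacobsonRadical_of_forall⟩

lemma map_mem_jacobsonRadical {S : Type*} [NonUnitalRing S] {F : Type*} [FunLike F R S]
    [NonUnitalRingHomClass F R S] (f : F) (hf : Function.Surjective f) {x : R}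
    (hx : x ∈ jacobsonRadical R) : f x ∈ jacobsonRadical S := by
  refine mem_jacobsonRadical_of_forall fun s => ?_
  obtain ⟨r, rfl⟩ := hf s
  obtain ⟨z, hz⟩ := mem_jacobsonRadical_iff.1 hx r
  exact ⟨f z, by rw [← map_mul, ← map_mul, hz, map_add]⟩

lemma isSemisimple_of_forall (h : ∀ x ∈ jacobsonRadical R, x = 0) : IsSemisimple R :=
  Set.Subset.antisymm h (by rintro _ rfl I _; exact I.zero_mem)

lemma IsSemisimple.eq_zero (h : IsSemisimple R) {x : R} (hx : x ∈ jacobsonRadical R) : x = 0 := by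
  rw [IsSemisimple] at h
  rwa [h] at hx

end RadicalTheory

/-! ### The radical of a Banach algebra is a closed subspace. -/

section RadicalNormed

variable {R : Type*} [NonUnitalNormedRing R] [CompleteSpace R]

/-- The quasi-inverse is the fixed point of the contraction `z ↦ y * z - y`. -/
lemma exists_quasiInverse_of_norm_lt_one {y : R} (hy : ‖y‖ < 1) : ∃ z, y * z = y + z := by
  have hc : ContractingWith ‖y‖₊ (fun z => y * z - y) := by
    refine ⟨by exact_mod_cast hy, LipschitzWith.of_dist_le_mul fun a b => ?_⟩
    rw [dist_eq_norm, dist_eq_norm, sub_sub_sub_cancel_right, ← mul_sub]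
    exact norm_mul_le _ _
  have := hc.fixedPoint_isFixedPt
  exact ⟨_, by rw [add_comm]; exact sub_eq_iff_eq_add.1 this⟩

/-- Otherwise the closure, a strictly larger right ideal, is everything, so some `x ∈ I` is within
distance `1` of the left unit `e`. Then `e - x` has a quasi-inverse, which forces `e ∈ I` as in
`mem_jacobsonRadical_of_forall`. -/
lemma IsMaximalRegularRightIdeal.isClosed {I : AddSubgroup R}
    (hI : IsMaximalRegularRightIdeal I) : IsClosed (I : Set R) := by
  have hr : IsRightIdeal I.topologicalClosure := fun x hx r =>
    map_mem_closure (f := fun y => y * r) (by fun_prop) hx fun y hy => hI.1.1 y hy r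
  by_contra hcl
  have hlt : I < I.topologicalClosure := by
    refine lt_of_le_of_ne I.le_topologicalClosure fun h => hcl ?_
    rw [h]; exact I.isClosed_topologicalClosure
  have htop := hI.2.2 _ hr hlt
  obtain ⟨e, he⟩ := hI.1.2
  have hecl : e ∈ closure (I : Set R) := (htop ▸ AddSubgroup.mem_top e : e ∈ I.topologicalClosure)
  obtain ⟨x, hx, hxe⟩ := Metric.mem_closure_iff.1 hecl 1 one_pos
  rw [dist_eq_norm] at hxe
  obtain ⟨z, hz⟩ := exists_quasiInverse_of_norm_lt_one hxe
  refine hI.not_mem_of_forall he ?_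
  have : e = (e * z - z) - x * z + x := by
    have h2 : e * z - x * z = e - x + z := by rw [← sub_mul, hz]
    calc e = (e - x + z) - z + x := by abel
      _ = _ := by rw [← h2]; abel
  rw [this]
  exact I.add_mem (I.sub_mem (he z) (hI.1.1 x hx z)) hx

lemma isClosed_jacobsonRadical : IsClosed (jacobsonRadical R) := by
  have : jacobsonRadical R = ⋂ (I : AddSubgroup R) (_ : IsMaximalRegularRightIdeal I), I := by
    ext; simp [jacobsonRadical]
  rw [this]
  exact isClosed_iInter fun I => isClosed_iInter fun hI => hI.isClosed

end RadicalNormed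

section RadicalAlgebra

variable (𝕜 : Type*) [CommRing 𝕜] (R : Type*) [NonUnitalRing R] [Module 𝕜 R] [SMulCommClass 𝕜 R R]
  [IsScalarTower 𝕜 R R]

/-- The Jacobson radical of an algebra as a linear subspace. -/
def jacobsonSubmodule : Submodule 𝕜 R where
  carrier := jacobsonRadical R
  add_mem' ha hb I hI := I.add_mem (ha I hI) (hb I hI)
  zero_mem' I _ := I.zero_mem
  smul_mem' c x hx := by
    refine mem_jacobsonRadical_of_forall fun r => ?_
    obtain ⟨z, hz⟩ := mem_jacobsonRadical_iff.1 hx (c • r)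
    exact ⟨z, by rwa [smul_mul_assoc, ← mul_smul_comm]⟩

end RadicalAlgebra

open MeasureTheory

/-! ### Fourier analysis on the compact dual of a discrete abelian group. -/

section Characters

/-- Characters into `ℚ/ℤ` separate points of any abelian group; they are composed with the
injections `ℚ/ℤ → ℝ/ℤ → Circle`. -/
lemma exists_character_ne_one {G : Type*} [CommGroup G] {t : G} (ht : t ≠ 1) :
    ∃ χ : G →* Circle, χ t ≠ 1 := by
  have h0 : Additive.ofMul t ≠ 0 := fun h => ht (Additive.ofMul.injective h)
  obtain ⟨c, hc⟩ := CharacterModule.exists_character_apply_ne_zero_of_ne_zero h0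
  let ψ : AddCircle (1 : ℚ) →+ AddCircle (1 : ℝ) :=
    QuotientAddGroup.map _ _ (Rat.castHom ℝ).toAddMonoidHom (by
      intro x hx
      obtain ⟨n, rfl⟩ := AddSubgroup.mem_zmultiples_iff.1 hx
      exact AddSubgroup.mem_zmultiples_iff.2 ⟨n, by simp⟩)
  have hψ : ∀ x, ψ x = 0 → x = 0 := by
    intro x
    induction x using QuotientAddGroup.induction_on with
    | H q =>
      intro h
      obtain ⟨n, hn⟩ := AddSubgroup.mem_zmultiples_iff.1 ((QuotientAddGroup.eq_zero_iff _).1 h)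
      refine (QuotientAddGroup.eq_zero_iff _).2 (AddSubgroup.mem_zmultiples_iff.2 ⟨n, ?_⟩)
      have hn' : ((n : ℚ) : ℝ) = (q : ℝ) := by simpa using hn
      simpa using Rat.cast_injective hn'
  refine ⟨{ toFun := fun s => AddCircle.toCircle (ψ (c (Additive.ofMul s)))
            map_one' := by simp
            map_mul' := fun a b => by simp [AddCircle.toCircle_add] }, fun h => hc (hψ _ ?_)⟩
  refine AddCircle.injective_toCircle one_ne_zero ?_
  rw [AddCircle.toCircle_zero]
  exact h

variable {G : Type*} [CommGroup G] [TopologicalSpace G]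

/-- Evaluation at an element of the group as a continuous function on the dual group. -/
def evalDual : G →* C(PontryaginDual G, ℂ) where
  toFun s := ⟨fun γ => (γ s : ℂ), continuous_induced_dom.comp
    (ContinuousEvalConst.continuous_eval_const (F := G →ₜ* Circle) s)⟩
  map_one' := by ext γ; simp
  map_mul' s t := by ext γ; simp

@[simp]
lemma evalDual_apply (s : G) (γ : PontryaginDual G) : evalDual s γ = (γ s : ℂ) := rfl

lemma star_evalDual (s : G) : star (evalDual s) = evalDual s⁻¹ := by
  ext γ
  simp [← Circle.coe_inv_eq_conj]

variable [DiscreteTopology G]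

/-- Stone–Weierstrass: the evaluations separate points and are closed under products and
conjugation, so their linear span is already a star subalgebra. -/
lemma span_evalDual_topologicalClosure :
    (Submodule.span ℂ (Set.range (evalDual (G := G)))).topologicalClosure = ⊤ := by
  have hstar : star (Set.range (evalDual (G := G))) = Set.range (evalDual (G := G)) := by
    ext f
    rw [Set.mem_star]
    constructor
    · rintro ⟨s, hs⟩
      exact ⟨s⁻¹, by rw [← star_evalDual, hs, star_star]⟩
    · rintro ⟨s, rfl⟩
      exact ⟨s⁻¹, (star_evalDual s).symm⟩
  have hspan : ((StarAlgebra.adjoin ℂ (Set.range (evalDual (G := G)))).toSubalgebra).toSubmodule =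
      Submodule.span ℂ (Set.range (evalDual (G := G))) := by
    rw [StarAlgebra.adjoin_toSubalgebra, hstar, Set.union_self, Algebra.adjoin_eq_span]
    congr 1
    exact congrArg SetLike.coe (Submonoid.closure_eq (MonoidHom.mrange (evalDual (G := G))))
  have hsep := ContinuousMap.starSubalgebra_topologicalClosure_eq_top_of_separatesPoints
    (StarAlgebra.adjoin ℂ (Set.range (evalDual (G := G)))) (by
      intro γ χ h
      obtain ⟨s, hs⟩ : ∃ s, γ s ≠ χ s := by
        by_contra! h'
        exact h (PontryaginDual.ext h')
      exact ⟨_, ⟨evalDual s, StarAlgebra.subset_adjoin ℂ _ ⟨s, rfl⟩, rfl⟩, fun h' =>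
        hs (Circle.ext h')⟩)
  rw [← hspan]
  refine eq_top_iff.2 fun f _ => ?_
  exact (hsep ▸ trivial : f ∈ (StarAlgebra.adjoin ℂ
    (Set.range (evalDual (G := G)))).topologicalClosure)

variable [MeasurableSpace (PontryaginDual G)] [BorelSpace (PontryaginDual G)]
  (μ : Measure (PontryaginDual G)) [μ.IsHaarMeasure]

lemma integrable_of_continuous_dual {E : Type*} [NormedAddCommGroup E]
    {f : PontryaginDual G → E} (hf : Continuous f) : Integrable f μ :=
  hf.integrable_of_hasCompactSupport (HasCompactSupport.of_compactSpace f)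

/-- Translating by a character `χ` with `χ t ≠ 1` multiplies the integral by `χ t`, while Haar
invariance leaves it unchanged. -/
lemma integral_evalDual_of_ne_one {t : G} (ht : t ≠ 1) : ∫ γ, evalDual t γ ∂μ = 0 := by
  obtain ⟨χ, hχ⟩ := exists_character_ne_one ht
  let χ' : PontryaginDual G := (⟨χ, continuous_of_discreteTopology⟩ : G →ₜ* Circle)
  have h := integral_mul_left_eq_self (μ := μ) (fun γ => evalDual t γ) χ'
  have h2 : ∀ γ : PontryaginDual G, evalDual t (χ' * γ) = (χ t : ℂ) * evalDual t γ := by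
    intro γ
    exact Circle.coe_mul _ _
  simp_rw [h2] at h
  rw [integral_const_mul] at h
  have h3 : ((χ t : ℂ) - 1) * ∫ γ, evalDual t γ ∂μ = 0 := by rw [sub_mul, h]; simp
  refine (mul_eq_zero.1 h3).resolve_left fun h4 => hχ (Circle.ext ?_)
  simpa using sub_eq_zero.1 h4

/-- A continuous function on the dual group with vanishing Fourier coefficients is zero. -/
lemma eq_zero_of_fourierCoeff_eq_zero (g : C(PontryaginDual G, ℂ))
    (hg : ∀ s : G, ∫ γ, evalDual s γ * g γ ∂μ = 0) : g = 0 := by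
  let T : C(PontryaginDual G, ℂ) →ₗ[ℂ] ℂ :=
    { toFun := fun p => ∫ γ, p γ * g γ ∂μ
      map_add' := fun p q => by
        simp only [ContinuousMap.add_apply, add_mul]
        exact integral_add (integrable_of_continuous_dual μ (by fun_prop))
          (integrable_of_continuous_dual μ (by fun_prop))
      map_smul' := fun c p => by
        simp only [ContinuousMap.smul_apply, smul_eq_mul, mul_assoc, RingHom.id_apply]
        exact integral_const_mul _ _ }
  let T' : C(PontryaginDual G, ℂ) →L[ℂ] ℂ := T.mkContinuous (‖g‖ * μ.real Set.univ) fun p => by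
    refine (norm_integral_le_of_norm_le_const (C := ‖p‖ * ‖g‖) (.of_forall fun γ => ?_)).trans
      (le_of_eq (by ring))
    rw [norm_mul]
    exact mul_le_mul (p.norm_coe_le_norm γ) (g.norm_coe_le_norm γ) (norm_nonneg _) (norm_nonneg _)
  -- Integration against `g` is a bounded functional that kills a dense subspace. Testing it on
  -- `star g` gives `∫ ‖g‖² = 0`.
  have hT : T' = 0 := ContinuousLinearMap.ext_on
    (Submodule.dense_iff_topologicalClosure_eq_top.2 span_evalDual_topologicalClosure) (by
      rintro _ ⟨s, rfl⟩
      exact hg s)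
  have h1 : ∫ γ, star (g γ) * g γ ∂μ = 0 := congrArg (fun F => F (star g)) hT
  have h2 : ∫ γ, ‖g γ‖ ^ 2 ∂μ = 0 := by
    have h3 : ∀ γ, star (g γ) * g γ = ((‖g γ‖ ^ 2 : ℝ) : ℂ) := fun γ => by
      rw [mul_comm]; simpa using Complex.mul_conj' (g γ)
    simp_rw [h3] at h1
    rw [integral_complex_ofReal] at h1
    exact_mod_cast h1
  have hc : Continuous fun γ => ‖g γ‖ ^ 2 := by fun_prop
  have h3 := (integral_eq_zero_iff_of_nonneg (fun γ => by positivity)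
    (integrable_of_continuous_dual μ hc)).1 h2
  have h4 := hc.ae_eq_iff_eq μ continuous_zero |>.1 h3
  ext γ
  simpa using congrFun h4 γ

end Characters

/-! ### Abstract Fourier systems and their semisimplicity. -/

section Fourier

/-- A Banach algebra `R` which is densely spanned by homogeneous components `ι s (A)`, `s ∈ G`,
multiplied as in a crossed product by `act`, with continuous Fourier coefficients `coeff s` and
with a contractive action `gauge` of the dual group. -/
structure FourierSystem (G A R : Type*) [CommGroup G]
    [NonUnitalNormedRing A] [NormedSpace ℂ A] [NonUnitalNormedRing R] [NormedSpace ℂ R] where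
  act : G → A → A
  act_one : ∀ a, act 1 a = a
  act_act_inv : ∀ s a, act s (act s⁻¹ a) = a
  ι : G → A →L[ℂ] R
  ι_mul_ι : ∀ s t a b, ι s a * ι t b = ι (s * t) (a * act s b)
  dense : Dense (Submodule.span ℂ {x : R | ∃ s a, ι s a = x} : Set R)
  coeff : G → R →L[ℂ] A
  coeff_ι_self : ∀ s a, coeff s (ι s a) = a
  coeff_ι_of_ne : ∀ s t a, s ≠ t → coeff s (ι t a) = 0
  gauge : (G →* Circle) → R →ₙₐ[ℂ] R
  norm_gauge_le : ∀ χ x, ‖gauge χ x‖ ≤ ‖x‖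
  gauge_ι : ∀ χ s a, gauge χ (ι s a) = (χ s : ℂ) • ι s a

namespace FourierSystem

variable {G A R : Type*} [CommGroup G]
  [NonUnitalNormedRing A] [NormedSpace ℂ A] [NonUnitalNormedRing R] [NormedSpace ℂ R]
  (S : FourierSystem G A R)

lemma clm_ext {E : Type*} [NormedAddCommGroup E] [NormedSpace ℂ E] {f g : R →L[ℂ] E}
    (h : ∀ s a, f (S.ι s a) = g (S.ι s a)) : f = g :=
  ContinuousLinearMap.ext_on S.dense (by rintro _ ⟨s, a, rfl⟩; exact h s a)

/-- The gauge action by continuous linear maps. -/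
def gaugeCLM (χ : G →* Circle) : R →L[ℂ] R :=
  LinearMap.mkContinuous (S.gauge χ : R →ₗ[ℂ] R) 1 fun x => by
    rw [one_mul]; exact S.norm_gauge_le χ x

@[simp]
lemma gaugeCLM_apply (χ : G →* Circle) (x : R) : S.gaugeCLM χ x = S.gauge χ x := rfl

lemma gauge_one (x : R) : S.gauge 1 x = x := by
  have : S.gaugeCLM 1 = ContinuousLinearMap.id ℂ R :=
    S.clm_ext fun s a => by simp [gauge_ι]
  exact congrArg (fun f => f x) this

lemma gauge_gauge_inv (χ : G →* Circle) (x : R) : S.gauge χ (S.gauge χ⁻¹ x) = x := by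
  have : (S.gaugeCLM χ).comp (S.gaugeCLM χ⁻¹) = ContinuousLinearMap.id ℂ R :=
    S.clm_ext fun s a => by simp [gauge_ι, smul_smul]
  exact congrArg (fun f => f x) this

lemma gauge_mem_jacobsonRadical (χ : G →* Circle) {x : R} (hx : x ∈ jacobsonRadical R) :
    S.gauge χ x ∈ jacobsonRadical R :=
  map_mem_jacobsonRadical (S.gauge χ) (fun y => ⟨_, S.gauge_gauge_inv χ y⟩) hx

/-- The coefficient at the identity is a left module map. -/
lemma coeff_one_ι_mul [IsScalarTower ℂ A A] [SMulCommClass ℂ A A] [IsScalarTower ℂ R R]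
    [SMulCommClass ℂ R R] (c : A) (y : R) :
    S.coeff 1 (S.ι 1 c * y) = c * S.coeff 1 y := by
  have : (S.coeff 1).comp (ContinuousLinearMap.mul ℂ R (S.ι 1 c)) =
      (ContinuousLinearMap.mul ℂ A c).comp (S.coeff 1) := S.clm_ext fun s a => by
    simp only [ContinuousLinearMap.comp_apply, ContinuousLinearMap.mul_apply', ι_mul_ι, one_mul,
      act_one]
    obtain rfl | hs := eq_or_ne 1 s
    · rw [coeff_ι_self, coeff_ι_self]
    · rw [coeff_ι_of_ne _ _ _ _ hs, coeff_ι_of_ne _ _ _ _ hs, mul_zero]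
  exact congrArg (fun f => f y) this

section Dual

variable [TopologicalSpace G]

/-- Orbits of finite sums of homogeneous elements are visibly continuous. Since the gauge maps are
contractive, every orbit is a uniform limit of such orbits. -/
lemma continuous_gauge (x : R) :
    Continuous fun γ : PontryaginDual G => S.gauge (γ : G →* Circle) x := by
  let M : Submodule ℂ R :=
    { carrier := {x | Continuous fun γ : PontryaginDual G => S.gauge (γ : G →* Circle) x}
      zero_mem' := by simpa using continuous_const
      add_mem' := fun {x y} hx hy => by
        simp only [Set.mem_ofPred_eq, map_add] at *
        exact hx.add hy
      smul_mem' := fun c x hx => by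
        simp only [Set.mem_ofPred_eq, map_smul] at *
        exact hx.const_smul c }
  have hM : Submodule.span ℂ {x : R | ∃ s a, S.ι s a = x} ≤ M := by
    refine Submodule.span_le.2 ?_
    rintro _ ⟨s, a, rfl⟩
    change Continuous _
    simp only [gauge_ι]
    exact (evalDual s).continuous.smul continuous_const
  refine continuous_of_uniform_approx_of_continuous fun u hu => ?_
  obtain ⟨ε, hε, hu⟩ := Metric.mem_uniformity_dist.1 hu
  obtain ⟨y, hy, hxy⟩ := Metric.mem_closure_iff.1 (S.dense x) ε hε
  refine ⟨_, hM hy, fun γ => hu (lt_of_le_of_lt ?_ hxy)⟩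
  rw [dist_eq_norm, dist_eq_norm, ← map_sub]
  exact S.norm_gauge_le _ _

lemma continuous_evalDual_smul_gauge (s : G) (x : R) :
    Continuous fun γ : PontryaginDual G => evalDual s⁻¹ γ • S.gauge (γ : G →* Circle) x :=
  (evalDual s⁻¹).continuous.smul (S.continuous_gauge x)

variable [DiscreteTopology G] [MeasurableSpace (PontryaginDual G)] [BorelSpace (PontryaginDual G)]
  (μ : Measure (PontryaginDual G)) [μ.IsHaarMeasure] [IsProbabilityMeasure μ]

/-- The projection onto a spectral subspace of the gauge action. -/
def spectralProj (s : G) : R →L[ℂ] R :=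
  LinearMap.mkContinuous
    { toFun := fun x => ∫ γ, evalDual s⁻¹ γ • S.gauge (γ : G →* Circle) x ∂μ
      map_add' := fun x y => by
        simp only [map_add, smul_add]
        exact integral_add
          (integrable_of_continuous_dual μ (S.continuous_evalDual_smul_gauge s x))
          (integrable_of_continuous_dual μ (S.continuous_evalDual_smul_gauge s y))
      map_smul' := fun c x => by
        simp only [map_smul, smul_comm _ c, RingHom.id_apply]
        exact integral_smul _ _ } 1 fun x => by
    refine (norm_integral_le_of_norm_le_const (C := ‖x‖) (.of_forall fun γ => ?_)).trans
      (le_of_eq (by simp))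
    rw [norm_smul, evalDual_apply, Circle.norm_coe, one_mul]
    exact S.norm_gauge_le _ _

lemma spectralProj_apply (s : G) (x : R) :
    S.spectralProj μ s x = ∫ γ, evalDual s⁻¹ γ • S.gauge (γ : G →* Circle) x ∂μ := rfl

variable [CompleteSpace R]

/-- Both sides are continuous and linear in `x`, so homogeneous `x` suffice; there it is
orthogonality of characters. -/
lemma spectralProj_eq (s : G) (x : R) : S.spectralProj μ s x = S.ι s (S.coeff s x) := by
  have : S.spectralProj μ s = (S.ι s).comp (S.coeff s) := S.clm_ext fun t a => by
    have h : ∀ γ : PontryaginDual G, evalDual s⁻¹ γ • S.gauge (γ : G →* Circle) (S.ι t a) =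
        evalDual (s⁻¹ * t) γ • S.ι t a := fun γ => by
      rw [gauge_ι, smul_smul, map_mul]; rfl
    rw [spectralProj_apply]
    simp_rw [h]
    rw [integral_smul_const, ContinuousLinearMap.comp_apply]
    obtain rfl | hs := eq_or_ne s t
    · simp [coeff_ι_self]
    · rw [coeff_ι_of_ne _ _ _ _ hs, integral_evalDual_of_ne_one, zero_smul, map_zero]
      rwa [Ne, inv_mul_eq_one]
  exact congrArg (fun f => f x) this

end Dual

variable [CompleteSpace R]

lemma ι_coeff_mem_jacobsonRadical [IsScalarTower ℂ R R] [SMulCommClass ℂ R R] (s : G) {x : R}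
    (hx : x ∈ jacobsonRadical R) : S.ι s (S.coeff s x) ∈ jacobsonRadical R := by
  let _ : TopologicalSpace G := ⊥
  have : DiscreteTopology G := ⟨rfl⟩
  let _ : MeasurableSpace (PontryaginDual G) := borel _
  have : BorelSpace (PontryaginDual G) := ⟨rfl⟩
  let μ : Measure (PontryaginDual G) := Measure.haarMeasure ⊤
  have : IsProbabilityMeasure μ := ⟨Measure.haarMeasure_self (K₀ := ⊤)⟩
  rw [← S.spectralProj_eq μ, spectralProj_apply]
  -- The mean over a probability measure of a function with values in a closed convex set stays in
  -- that set.
  refine ((jacobsonSubmodule ℂ R).restrictScalars ℝ).convex.integral_mem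
    isClosed_jacobsonRadical (.of_forall fun γ => ?_)
    (integrable_of_continuous_dual μ (S.continuous_evalDual_smul_gauge s x))
  exact (jacobsonSubmodule ℂ R).smul_mem _ (S.gauge_mem_jacobsonRadical _ hx)

/-- For each functional `φ`, the function `γ ↦ φ (γ · x)` on the dual group is continuous with
vanishing Fourier coefficients, hence zero; its value at the trivial character is `φ x`. -/
lemma eq_zero_of_coeff_eq_zero {x : R} (hx : ∀ s, S.coeff s x = 0) : x = 0 := by
  let _ : TopologicalSpace G := ⊥
  have : DiscreteTopology G := ⟨rfl⟩
  let _ : MeasurableSpace (PontryaginDual G) := borel _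
  have : BorelSpace (PontryaginDual G) := ⟨rfl⟩
  let μ : Measure (PontryaginDual G) := Measure.haarMeasure ⊤
  have : IsProbabilityMeasure μ := ⟨Measure.haarMeasure_self (K₀ := ⊤)⟩
  refine SeparatingDual.eq_zero_of_forall_dual_eq_zero (R := ℂ) fun φ => ?_
  let g : C(PontryaginDual G, ℂ) :=
    ⟨fun γ => φ (S.gauge (γ : G →* Circle) x), φ.continuous.comp (S.continuous_gauge x)⟩
  have hg : g = 0 := eq_zero_of_fourierCoeff_eq_zero μ g fun s => by
    have h := φ.integral_comp_comm
      (integrable_of_continuous_dual μ (S.continuous_evalDual_smul_gauge s⁻¹ x))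
    rw [← spectralProj_apply, spectralProj_eq, hx, map_zero, map_zero] at h
    simpa [g] using h
  have h1 : φ (S.gauge ((1 : PontryaginDual G) : G →* Circle) x) = 0 :=
    congrArg (fun f => f 1) hg
  have h2 : ((1 : PontryaginDual G) : G →* Circle) = 1 := rfl
  rwa [h2, gauge_one] at h1

theorem isSemisimple (S : FourierSystem G A R) [IsScalarTower ℂ A A] [SMulCommClass ℂ A A]
    [IsScalarTower ℂ R R] [SMulCommClass ℂ R R] (hA : IsSemisimple A) : IsSemisimple R := by
  refine isSemisimple_of_forall fun x hx => S.eq_zero_of_coeff_eq_zero fun s => ?_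
  refine hA.eq_zero (mem_jacobsonRadical_of_forall fun b => ?_)
  -- The right factor is chosen so that the product is the degree-one element `ι 1 (coeff s x * b)`:
  -- the action of `s` undoes that of `s⁻¹`.
  have h := mul_mem_jacobsonRadical (S.ι_coeff_mem_jacobsonRadical s hx) (S.ι s⁻¹ (S.act s⁻¹ b))
  rw [ι_mul_ι, act_act_inv, mul_inv_cancel] at h
  obtain ⟨y, hy⟩ := exists_quasiInverse_of_mem_jacobsonRadical h
  refine ⟨S.coeff 1 y, ?_⟩
  -- Applying the `A`-linear coefficient at `1` to the quasi-inverse equation in `R` gives the same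
  -- equation in `A`.
  rw [← coeff_one_ι_mul, hy, map_add, coeff_ι_self]

end FourierSystem

end Fourier

/-! ### The regular covariant representation on `ℓ²(G, K)`. -/

section RegularRepresentation

variable {K : Type*} [NormedAddCommGroup K] [InnerProductSpace ℂ K]

/-- A permutation of the index set acts on `ℓ²` by a linear isometry. -/
def lpReindex {I J : Type*} (e : J ≃ I) : lp (fun _ : I => K) 2 ≃ₗᵢ[ℂ] lp (fun _ : J => K) 2 where
  toFun ξ := ⟨fun j => ξ (e j), (memℓp_gen_iff (by norm_num)).2
    (e.summable_iff.2 ((memℓp_gen_iff (by norm_num)).1 (lp.memℓp ξ)))⟩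
  invFun ξ := ⟨fun i => ξ (e.symm i), (memℓp_gen_iff (by norm_num)).2
    (e.symm.summable_iff.2 ((memℓp_gen_iff (by norm_num)).1 (lp.memℓp ξ)))⟩
  map_add' _ _ := rfl
  map_smul' _ _ := rfl
  left_inv ξ := lp.ext (funext fun i => congrArg ξ (e.apply_symm_apply i))
  right_inv ξ := lp.ext (funext fun j => congrArg ξ (e.symm_apply_apply j))
  norm_map' ξ := by
    rw [lp.norm_eq_tsum_rpow (by norm_num), lp.norm_eq_tsum_rpow (by norm_num)]
    congr 1
    exact e.tsum_eq fun i => ‖ξ i‖ ^ (2 : ℝ≥0∞).toReal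

variable [CompleteSpace K] {G : Type v} [Group G] {C : Type w} [NonUnitalCStarAlgebra C]
  (β : G →* (C ≃⋆ₐ[ℂ] C)) (ρ : C →⋆ₙₐ[ℂ] (K →L[ℂ] K))

lemma norm_diagonal_le (c : C) (g : ULift.{w} G) : ‖ρ (β g.down⁻¹ c)‖ ≤ ‖c‖ :=
  (NonUnitalStarAlgHom.norm_apply_le ρ _).trans
    (NonUnitalStarAlgHom.norm_apply_le (β g.down⁻¹ : C →⋆ₙₐ[ℂ] C) c)

/-- The diagonal operator `ξ ↦ (g ↦ ρ (β_g⁻¹ c) (ξ g))` on `ℓ²(G, K)`. -/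
def diagonalOperator (c : C) :
    lp (fun _ : ULift.{w} G => K) 2 →L[ℂ] lp (fun _ : ULift.{w} G => K) 2 :=
  lp.mapCLM 2 (fun g : ULift.{w} G => ρ (β g.down⁻¹ c)) (norm_nonneg c) (norm_diagonal_le β ρ c)

@[simp]
lemma diagonalOperator_apply (c : C) (ξ : lp (fun _ : ULift.{w} G => K) 2) (g : ULift.{w} G) :
    diagonalOperator β ρ c ξ g = ρ (β g.down⁻¹ c) (ξ g) := rfl

/-- The diagonal representation on `ℓ²(G, K)`. -/
def diagonalRep : C →⋆ₙₐ[ℂ]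
    (lp (fun _ : ULift.{w} G => K) 2 →L[ℂ] lp (fun _ : ULift.{w} G => K) 2) where
  toFun := diagonalOperator β ρ
  map_smul' z c := by ext ξ g; simp
  map_zero' := by ext ξ g; simp
  map_add' c d := by ext ξ g; simp
  map_mul' c d := by ext ξ g; simp
  map_star' c := by
    rw [ContinuousLinearMap.star_eq_adjoint, ContinuousLinearMap.eq_adjoint_iff]
    intro ξ η
    rw [lp.inner_eq_tsum, lp.inner_eq_tsum]
    refine tsum_congr fun g => ?_
    rw [diagonalOperator_apply, diagonalOperator_apply, map_star, map_star,
      ContinuousLinearMap.star_eq_adjoint, ContinuousLinearMap.adjoint_inner_left]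

/-- Left translation on `ℓ²(G, K)`. -/
def translation : G →* unitary
    (lp (fun _ : ULift.{w} G => K) 2 →L[ℂ] lp (fun _ : ULift.{w} G => K) 2) :=
  (Unitary.linearIsometryEquiv (𝕜 := ℂ)).symm.toMonoidHom.comp
    { toFun := fun s => lpReindex ((Equiv.ulift.trans (Equiv.mulLeft s⁻¹)).trans Equiv.ulift.symm)
      map_one' := LinearIsometryEquiv.ext fun ξ => lp.ext (funext fun g =>
        congrArg (fun h => ξ (ULift.up h)) (show (1 : G)⁻¹ * g.down = g.down by simp))
      map_mul' := fun s t => LinearIsometryEquiv.ext fun ξ => lp.ext (funext fun g =>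
        congrArg (fun h => ξ (ULift.up h))
          (show (s * t)⁻¹ * g.down = t⁻¹ * (s⁻¹ * g.down) by simp [mul_assoc])) }

end RegularRepresentation

section Regular

variable {K : Type u} [NormedAddCommGroup K] [InnerProductSpace ℂ K] [CompleteSpace K]
  {G : Type v} [Group G] {C : Type (u + 1)} [NonUnitalCStarAlgebra C]
  (β : G →* (C ≃⋆ₐ[ℂ] C)) (ρ : C →⋆ₙₐ[ℂ] (K →L[ℂ] K))

/-- The regular covariant representation induced by `ρ`. -/
def regularRep : CovariantRep β where
  -- Lifting the index set places this space in the universe required by `CovariantRep`.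
  K := lp (fun _ : ULift.{u + 1} G => K) 2
  π := diagonalRep β ρ
  u := translation
  covariant s c := by
    refine ContinuousLinearMap.ext fun ξ => lp.ext (funext fun g => ?_)
    -- At `g`, both sides are `ρ (β_{g⁻¹s} c)` applied to `ξ (s⁻¹ g)`.
    change ρ (β (s⁻¹ * g.down)⁻¹ c) (ξ _) = ρ (β g.down⁻¹ (β s c)) (ξ _)
    rw [mul_inv_rev, inv_inv, map_mul]
    rfl

end Regular

/-! ### The dual action on the product of all covariant representations. -/

section Product

variable {G : Type v} [Group G] {C : Type w} [NonUnitalCStarAlgebra C]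
  {β : G →* (C ≃⋆ₐ[ℂ] C)}

/-- The coordinate of an element of the product at a covariant representation. -/
def CovariantProduct.coord (r : CovariantRep β) : CovariantProduct β →L[ℂ] (r.K →L[ℂ] r.K) :=
  lp.evalCLM ℂ (fun r : CovariantRep β => r.K →L[ℂ] r.K) ∞ r

lemma CovariantProduct.ext {x y : CovariantProduct β} (h : ∀ r, coord r x = coord r y) : x = y :=
  lp.ext (E := fun r : CovariantRep β => r.K →L[ℂ] r.K) (funext h)

lemma CovariantProduct.coord_mul (r : CovariantRep β) (x y : CovariantProduct β) :
    coord r (x * y) = coord r x * coord r y := rfl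

lemma CovariantRep.integrated_single (r : CovariantRep β) (s : G) (c : C) :
    r.integrated (Finsupp.single s c) = r.π c * (r.u s : r.K →L[ℂ] r.K) := by
  rw [CovariantRep.integrated, Finsupp.sum_single_index]
  rw [map_zero, zero_mul]

lemma coord_universalIntegrated_single (r : CovariantRep β) (s : G) (c : C) :
    CovariantProduct.coord r (universalIntegrated β (Finsupp.single s c)) =
      r.π c * (r.u s : r.K →L[ℂ] r.K) :=
  r.integrated_single s c

/-- The covariant representation with the unitaries multiplied by a character. -/
def CovariantRep.mulCharacter (r : CovariantRep β) (χ : G →* Circle) : CovariantRep β where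
  K := r.K
  π := r.π
  u :=
    { toFun := fun s => ⟨(χ s : ℂ) • (r.u s : r.K →L[ℂ] r.K), by
        have h1 : (starRingEnd ℂ) (χ s : ℂ) * (χ s : ℂ) = 1 := by
          rw [← Circle.coe_inv_eq_conj, ← Circle.coe_mul, inv_mul_cancel, Circle.coe_one]
        have h2 : star (r.u s : r.K →L[ℂ] r.K) * (r.u s : r.K →L[ℂ] r.K) = 1 :=
          Unitary.star_mul_self_of_mem (r.u s).2
        have h3 : (r.u s : r.K →L[ℂ] r.K) * star (r.u s : r.K →L[ℂ] r.K) = 1 :=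
          Unitary.mul_star_self_of_mem (r.u s).2
        rw [Unitary.mem_iff, star_smul, smul_mul_smul_comm, smul_mul_smul_comm, h2, h3]
        exact ⟨by rw [RCLike.star_def, h1, one_smul],
          by rw [RCLike.star_def, mul_comm, h1, one_smul]⟩⟩
      map_one' := Subtype.ext (by simp)
      map_mul' := fun s t => Subtype.ext (by
        simp [smul_smul, mul_comm]) }
  covariant s c := by
    change ((χ s : ℂ) • (r.u s : r.K →L[ℂ] r.K)) * r.π c =
      r.π (β s c) * ((χ s : ℂ) • (r.u s : r.K →L[ℂ] r.K))
    rw [smul_mul_assoc, mul_smul_comm, r.covariant]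

/-- The dual action on the product over all covariant representations. -/
def gaugeHom (χ : G →* Circle) : CovariantProduct β →⋆ₙₐ[ℂ] CovariantProduct β where
  toFun (x : lp (fun r : CovariantRep β => r.K →L[ℂ] r.K) ∞) :=
    (⟨fun r => x (r.mulCharacter χ), memℓp_infty ⟨‖x‖, by
      rintro _ ⟨r, rfl⟩
      exact lp.norm_apply_le_norm ENNReal.top_ne_zero x (r.mulCharacter χ)⟩⟩ :
      lp (fun r : CovariantRep β => r.K →L[ℂ] r.K) ∞)
  map_smul' _ _ := rfl
  map_zero' := rfl
  map_add' _ _ := rfl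
  map_mul' _ _ := rfl
  map_star' _ := rfl

lemma coord_gaugeHom (χ : G →* Circle) (r : CovariantRep β) (x : CovariantProduct β) :
    CovariantProduct.coord r (gaugeHom χ x) = CovariantProduct.coord (r.mulCharacter χ) x := rfl

lemma gaugeHom_universalIntegrated_single (χ : G →* Circle) (s : G) (c : C) :
    gaugeHom χ (universalIntegrated β (Finsupp.single s c)) =
      (χ s : ℂ) • universalIntegrated β (Finsupp.single s c) := by
  refine CovariantProduct.ext fun r => ?_
  rw [coord_gaugeHom, map_smul, coord_universalIntegrated_single, coord_universalIntegrated_single]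
  exact mul_smul_comm (χ s : ℂ) (r.π c) (r.u s : r.K →L[ℂ] r.K)

lemma universalIntegrated_eq_sum (f : G →₀ C) :
    universalIntegrated β f = f.sum fun s c => universalIntegrated β (Finsupp.single s c) := by
  refine CovariantProduct.ext fun r => ?_
  rw [Finsupp.sum, map_sum]
  exact Finset.sum_congr rfl fun s _ => (coord_universalIntegrated_single r s (f s)).symm

lemma universalIntegrated_single_mul_single (s t : G) (c d : C) :
    universalIntegrated β (Finsupp.single s c) * universalIntegrated β (Finsupp.single t d) =
      universalIntegrated β (Finsupp.single (s * t) (c * β s d)) := by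
  refine CovariantProduct.ext fun r => ?_
  rw [CovariantProduct.coord_mul]
  simp only [coord_universalIntegrated_single, map_mul, Submonoid.coe_mul]
  rw [mul_assoc, ← mul_assoc (r.u s : r.K →L[ℂ] r.K), r.covariant, mul_assoc, mul_assoc]

lemma norm_universalIntegrated_single_le (s : G) (c : C) :
    ‖universalIntegrated β (Finsupp.single s c)‖ ≤ ‖c‖ := by
  refine lp.norm_le_of_forall_le (E := fun r : CovariantRep β => r.K →L[ℂ] r.K)
    (norm_nonneg c) fun r => ?_
  refine (r.norm_integrated_le (Finsupp.single s c)).trans (le_of_eq ?_)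
  rw [Finsupp.sum_single_index]
  exact norm_zero

end Product

/-! ### Coordinates of the maximal C⋆-cover. -/

section MaxCoordinates

variable {H : Type u} [NormedAddCommGroup H] [InnerProductSpace ℂ H] [CompleteSpace H]
  {A : NonUnitalSubalgebra ℂ (H →L[ℂ] H)}

variable (A) in
/-- The identity representation of an operator algebra. -/
def inclusionRep : Rep A where
  K := H
  π := NonUnitalSubalgebraClass.subtype A
  contractive _ _ := le_rfl

/-- The ⋆-homomorphism on `C⋆_max(A)` extending a completely contractive homomorphism. -/
def Rep.extend (r : Rep A) : CStarMax A →⋆ₙₐ[ℂ] (r.K →L[ℂ] r.K) where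
  toFun (x : maxSubalgebra A) := RepProduct.coord (x : RepProduct A) r
  map_smul' _ _ := rfl
  map_zero' := rfl
  map_add' _ _ := rfl
  map_mul' _ _ := rfl
  map_star' _ := rfl

lemma norm_toCStarMax_le (a : A) : ‖toCStarMax a‖ ≤ ‖a‖ :=
  lp.norm_le_of_forall_le (E := fun r : Rep A => r.K →L[ℂ] r.K) (norm_nonneg a)
    fun r => r.norm_le a

/-- The canonical embedding `A → C⋆_max(A)` as a homomorphism. -/
def toCStarMaxHom : A →ₙₐ[ℂ] CStarMax A where
  toFun := toCStarMax
  map_smul' c a := Subtype.ext (lp.ext (E := fun r : Rep A => r.K →L[ℂ] r.K)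
    (funext fun r => map_smul r.π c a))
  map_zero' := Subtype.ext (lp.ext (E := fun r : Rep A => r.K →L[ℂ] r.K)
    (funext fun r => map_zero r.π))
  map_add' a b := Subtype.ext (lp.ext (E := fun r : Rep A => r.K →L[ℂ] r.K)
    (funext fun r => map_add r.π a b))
  map_mul' a b := Subtype.ext (lp.ext (E := fun r : Rep A => r.K →L[ℂ] r.K)
    (funext fun r => map_mul r.π a b))

end MaxCoordinates

/-! ### Fourier coefficients as matrix entries of the regular representation. -/

section Coefficients

variable {H : Type u} [NormedAddCommGroup H] [InnerProductSpace ℂ H] [CompleteSpace H]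
  {A : NonUnitalSubalgebra ℂ (H →L[ℂ] H)} {G : Type v} [Group G] (α : Action G A)

/-- The Fourier coefficient at `s`: the compression of the regular representation to a matrix
entry. -/
def productCoeff (s : G) : CovariantProduct (maxAction α) →L[ℂ] (H →L[ℂ] H) :=
  letI := Classical.decEq (ULift.{u + 1} G)
  letI Λ := regularRep (maxAction α) (inclusionRep A).extend
  letI ev : Λ.K →L[ℂ] H := lp.evalCLM ℂ (fun _ : ULift.{u + 1} G => H) 2 (ULift.up 1)
  -- Translation by `t` moves the basis position `s⁻¹` to `t s⁻¹`, which is the position `1` read by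
  -- `ev` exactly when `t = s`. At position `1` the diagonal operator is untwisted, so the entry is
  -- `a` itself.
  letI δ : H →L[ℂ] Λ.K :=
    lp.singleContinuousLinearMap ℂ (fun _ : ULift.{u + 1} G => H) 2 (ULift.up s⁻¹)
  ((ContinuousLinearMap.compL ℂ H Λ.K H ev).comp
    ((ContinuousLinearMap.compL ℂ H Λ.K Λ.K).flip δ)).comp (CovariantProduct.coord Λ)

lemma productCoeff_single (s t : G) (a : A) [Decidable (s = t)] :
    productCoeff α s (universalIntegrated (maxAction α) (Finsupp.single t (toCStarMax a))) =
      if s = t then (a : H →L[ℂ] H) else 0 := by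
  let _ := Classical.decEq (ULift.{u + 1} G)
  ext v
  have hval : ∀ b : A, (inclusionRep A).extend (maxAction α (1 : G)⁻¹ (toCStarMax b)) =
      (b : H →L[ℂ] H) := fun b => by
    rw [inv_one, map_one]; rfl
  have h : productCoeff α s
      (universalIntegrated (maxAction α) (Finsupp.single t (toCStarMax a))) v =
      (a : H →L[ℂ] H) (lp.single (E := fun _ : ULift.{u + 1} G => H) 2 (ULift.up s⁻¹) v
        (ULift.up (t⁻¹ * 1))) := by
    rw [← hval a]
    have h1 := coord_universalIntegrated_single
      (regularRep (maxAction α) (inclusionRep A).extend) t (toCStarMax a)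
    exact congrArg (fun T : lp (fun _ : ULift.{u + 1} G => H) 2 →L[ℂ]
      lp (fun _ : ULift.{u + 1} G => H) 2 =>
        T (lp.single (E := fun _ : ULift.{u + 1} G => H) 2 (ULift.up s⁻¹) v) (ULift.up 1)) h1
  rw [h, mul_one]
  split_ifs with hst
  · subst hst
    rw [lp.single_apply_self]
  · rw [lp.single_apply_ne, map_zero]
    · rfl
    · intro h'
      exact hst (inv_injective (ULift.up_injective h')).symm

end Coefficients

/-! ### Homogeneous elements `a u_s` and their dense span. -/

section Embedding

variable {H : Type u} [NormedAddCommGroup H] [InnerProductSpace ℂ H] [CompleteSpace H]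
  {A : NonUnitalSubalgebra ℂ (H →L[ℂ] H)} {G : Type v} [Group G] (α : Action G A)

/-- The element `a u_s` of the crossed product. -/
def homogeneous (s : G) (a : A) : crossedProduct α :=
  ⟨toCStarCrossedProduct (maxAction α) (Finsupp.single s (toCStarMax a)),
    NonUnitalSubalgebra.le_topologicalClosure _ (NonUnitalAlgebra.subset_adjoin ℂ
      ⟨_, fun t => by
        classical
        rw [Finsupp.single_apply]
        split_ifs
        · exact ⟨a, rfl⟩
        · exact ⟨0, map_zero toCStarMaxHom⟩, rfl⟩)⟩

/-- The inclusion of the crossed product in the product over all covariant representations. -/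
def toProduct : crossedProduct α →ₙₐ[ℂ] CovariantProduct (maxAction α) where
  toFun x := (show crossedSubalgebra (maxAction α) from x.1).1
  map_smul' _ _ := rfl
  map_zero' := rfl
  map_add' _ _ := rfl
  map_mul' _ _ := rfl

lemma toProduct_injective : Function.Injective (toProduct α) := fun _ _ h =>
  Subtype.ext (Subtype.ext h)

lemma norm_toProduct (x : crossedProduct α) : ‖toProduct α x‖ = ‖x‖ := rfl

lemma toProduct_homogeneous (s : G) (a : A) : toProduct α (homogeneous α s a) =
    universalIntegrated (maxAction α) (Finsupp.single s (toCStarMax a)) := rfl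

lemma universalIntegrated_single_add (s : G) (c d : CStarMax A) :
    universalIntegrated (maxAction α) (Finsupp.single s (c + d)) =
      universalIntegrated (maxAction α) (Finsupp.single s c) +
        universalIntegrated (maxAction α) (Finsupp.single s d) := by
  refine CovariantProduct.ext fun r => ?_
  rw [map_add]
  simp only [coord_universalIntegrated_single]
  rw [map_add, add_mul]

lemma universalIntegrated_single_smul (s : G) (z : ℂ) (c : CStarMax A) :
    universalIntegrated (maxAction α) (Finsupp.single s (z • c)) =
      z • universalIntegrated (maxAction α) (Finsupp.single s c) := by
  refine CovariantProduct.ext fun r => ?_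
  rw [map_smul]
  simp only [coord_universalIntegrated_single]
  rw [map_smul, smul_mul_assoc]

/-- `a ↦ a u_s` as a continuous linear map. -/
def homogeneousCLM (s : G) : A →L[ℂ] crossedProduct α :=
  LinearMap.mkContinuous
    { toFun := homogeneous α s
      map_add' := fun a b => toProduct_injective α <| by
        rw [map_add, toProduct_homogeneous, toProduct_homogeneous, toProduct_homogeneous,
          ← universalIntegrated_single_add]
        exact congrArg (fun c => universalIntegrated (maxAction α) (Finsupp.single s c))
          (map_add toCStarMaxHom a b)
      map_smul' := fun z a => toProduct_injective α <| by
        rw [RingHom.id_apply, map_smul, toProduct_homogeneous, toProduct_homogeneous,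
          ← universalIntegrated_single_smul]
        exact congrArg (fun c => universalIntegrated (maxAction α) (Finsupp.single s c))
          (map_smul toCStarMaxHom z a) } 1 fun a => by
    rw [one_mul, ← norm_toProduct]
    exact (norm_universalIntegrated_single_le s _).trans (norm_toCStarMax_le a)

lemma homogeneousCLM_apply (s : G) (a : A) : homogeneousCLM α s a = homogeneous α s a := rfl

lemma homogeneous_mul_homogeneous (s t : G) (a b : A) :
    homogeneous α s a * homogeneous α t b = homogeneous α (s * t) (a * α.toFun s b) := by
  refine toProduct_injective α ?_
  rw [map_mul, toProduct_homogeneous, toProduct_homogeneous, toProduct_homogeneous,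
    universalIntegrated_single_mul_single]
  exact congrArg (fun c => universalIntegrated (maxAction α) (Finsupp.single (s * t) c))
    (map_mul toCStarMaxHom a (α.toFun s b)).symm

/-- Products of homogeneous elements are homogeneous, so the span is already a subalgebra and
generating an algebra from it adds nothing. -/
lemma mul_mem_span_homogeneous {x y : crossedProduct α}
    (hx : x ∈ Submodule.span ℂ {x | ∃ s a, homogeneousCLM α s a = x})
    (hy : y ∈ Submodule.span ℂ {x | ∃ s a, homogeneousCLM α s a = x}) :
    x * y ∈ Submodule.span ℂ {x | ∃ s a, homogeneousCLM α s a = x} := by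
  induction hx, hy using Submodule.span_induction₂ with
  | mem_mem x y hx hy =>
    obtain ⟨s, a, rfl⟩ := hx
    obtain ⟨t, b, rfl⟩ := hy
    exact Submodule.subset_span ⟨s * t, _, (homogeneous_mul_homogeneous α s t a b).symm⟩
  | zero_left y hy => rw [zero_mul]; exact Submodule.zero_mem _
  | zero_right x hx => rw [mul_zero]; exact Submodule.zero_mem _
  | add_left x y z _ _ _ h h' => rw [add_mul]; exact Submodule.add_mem _ h h'
  | add_right x y z _ _ _ h h' => rw [mul_add]; exact Submodule.add_mem _ h h'
  | smul_left r x y _ _ h => rw [smul_mul_assoc]; exact Submodule.smul_mem _ r h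
  | smul_right r x y _ _ h => rw [mul_smul_comm]; exact Submodule.smul_mem _ r h

/-- The crossed product is densely spanned by the elements `a u_s`. -/
lemma dense_span_homogeneous :
    Dense (Submodule.span ℂ {x | ∃ s a, homogeneousCLM α s a = x} : Set (crossedProduct α)) := by
  have hadj : ∀ d ∈ NonUnitalAlgebra.adjoin ℂ {x | ∃ f : G →₀ CStarMax A,
      (∀ s, f s ∈ Set.range (toCStarMax (A := A))) ∧ toCStarCrossedProduct (maxAction α) f = x},
      ∃ y ∈ Submodule.span ℂ {x | ∃ s a, homogeneousCLM α s a = x}, y.1 = d := by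
    intro d hd
    induction hd using NonUnitalAlgebra.adjoin_induction with
    | mem d hd =>
      obtain ⟨f, hf, rfl⟩ := hd
      choose a ha using hf
      refine ⟨∑ s ∈ f.support, homogeneousCLM α s (a s),
        Submodule.sum_mem _ fun s _ => Submodule.subset_span ⟨s, a s, rfl⟩, ?_⟩
      refine Subtype.ext ?_
      change toProduct α _ = universalIntegrated (maxAction α) f
      rw [universalIntegrated_eq_sum, map_sum, Finsupp.sum]
      refine Finset.sum_congr rfl fun s _ => ?_
      rw [homogeneousCLM_apply, toProduct_homogeneous, ha]
    | zero => exact ⟨0, Submodule.zero_mem _, rfl⟩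
    | add d d' _ _ hd hd' =>
      obtain ⟨y, hy, rfl⟩ := hd
      obtain ⟨y', hy', rfl⟩ := hd'
      exact ⟨y + y', Submodule.add_mem _ hy hy', rfl⟩
    | smul c d _ hd =>
      obtain ⟨y, hy, rfl⟩ := hd
      exact ⟨c • y, Submodule.smul_mem _ c hy, rfl⟩
    | mul d d' _ _ hd hd' =>
      obtain ⟨y, hy, rfl⟩ := hd
      obtain ⟨y', hy', rfl⟩ := hd'
      exact ⟨y * y', mul_mem_span_homogeneous α hy hy', rfl⟩
  intro x
  rw [closure_subtype]
  refine closure_mono ?_ x.2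
  intro d hd
  obtain ⟨y, hy, rfl⟩ := hadj d hd
  exact ⟨y, hy, rfl⟩

end Embedding

/-! ### Restricting the dual action and the coefficients to the crossed product. -/

section Gauge

variable {H : Type u} [NormedAddCommGroup H] [InnerProductSpace ℂ H] [CompleteSpace H]
  {A : NonUnitalSubalgebra ℂ (H →L[ℂ] H)} {G : Type v} [Group G] (α : Action G A)

/-- Closedness lets invariance of the range under the dual action be checked on the dense span of
homogeneous elements. -/
lemma isClosed_range_toProduct : IsClosed (Set.range (toProduct α)) := by
  have h1 : IsClosed (Set.range
      (Subtype.val : crossedProduct α → CStarCrossedProduct (maxAction α))) := by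
    rw [Subtype.range_coe]
    exact NonUnitalSubalgebra.isClosed_topologicalClosure _
  have h2 : Topology.IsClosedEmbedding (Subtype.val : crossedSubalgebra (maxAction α) →
      CovariantProduct (maxAction α)) :=
    (inferInstance : IsClosed (crossedSubalgebra (maxAction α) :
      Set (CovariantProduct (maxAction α)))).isClosedEmbedding_subtypeVal
  have h3 := h2.isClosedMap _ h1
  exact (Set.range_comp (Subtype.val : crossedSubalgebra (maxAction α) → _)
    (Subtype.val : crossedProduct α → CStarCrossedProduct (maxAction α))) ▸ h3

lemma continuous_toProduct : Continuous (toProduct α) :=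
  continuous_subtype_val.comp continuous_subtype_val

lemma gaugeHom_mem_range (χ : G →* Circle) (x : crossedProduct α) :
    gaugeHom χ (toProduct α x) ∈ Set.range (toProduct α) := by
  have hcont : Continuous (gaugeHom (β := maxAction α) χ) :=
    AddMonoidHomClass.continuous_of_bound (gaugeHom χ) 1 fun x => by
      simpa using NonUnitalStarAlgHom.norm_apply_le (gaugeHom (β := maxAction α) χ) x
  refine (dense_span_homogeneous α).induction ?_
    ((isClosed_range_toProduct α).preimage (hcont.comp (continuous_toProduct α))) x
  intro y hy
  induction hy using Submodule.span_induction with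
  | mem y hy =>
    obtain ⟨s, a, rfl⟩ := hy
    refine ⟨(χ s : ℂ) • homogeneous α s a, ?_⟩
    rw [homogeneousCLM_apply, map_smul, toProduct_homogeneous, gaugeHom_universalIntegrated_single]
  | zero => exact ⟨0, by simp⟩
  | add y z _ _ hy hz =>
    obtain ⟨y', hy⟩ := hy
    obtain ⟨z', hz⟩ := hz
    exact ⟨y' + z', by rw [map_add, map_add, map_add, hy, hz]⟩
  | smul c y _ hy =>
    obtain ⟨y', hy⟩ := hy
    exact ⟨c • y', by rw [map_smul, map_smul, map_smul, hy]⟩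

/-- The dual action on the crossed product, as a function. -/
def gaugeFun (χ : G →* Circle) (x : crossedProduct α) : crossedProduct α :=
  (gaugeHom_mem_range α χ x).choose

lemma toProduct_gaugeFun (χ : G →* Circle) (x : crossedProduct α) :
    toProduct α (gaugeFun α χ x) = gaugeHom χ (toProduct α x) :=
  (gaugeHom_mem_range α χ x).choose_spec

/-- The dual action on the crossed product. -/
def gauge (χ : G →* Circle) : crossedProduct α →ₙₐ[ℂ] crossedProduct α where
  toFun := gaugeFun α χ
  map_smul' c x := toProduct_injective α <| by
    rw [MonoidHom.id_apply, map_smul, toProduct_gaugeFun, toProduct_gaugeFun, map_smul, map_smul]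
  map_zero' := toProduct_injective α <| by
    rw [toProduct_gaugeFun, map_zero, map_zero]
  map_add' x y := toProduct_injective α <| by
    simp only [map_add, toProduct_gaugeFun]
  map_mul' x y := toProduct_injective α <| by
    simp only [map_mul, toProduct_gaugeFun]

lemma toProduct_gauge (χ : G →* Circle) (x : crossedProduct α) :
    toProduct α (gauge α χ x) = gaugeHom χ (toProduct α x) :=
  toProduct_gaugeFun α χ x

/-- A coefficient is a priori only an operator in `B(H)`. It lies in `A` for homogeneous elements,
hence for all elements by linearity, continuity and closedness of `A`. -/
lemma productCoeff_mem (hA : IsClosed (A : Set (H →L[ℂ] H))) (s : G) (x : crossedProduct α) :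
    productCoeff α s (toProduct α x) ∈ A := by
  classical
  refine (dense_span_homogeneous α).induction (P := fun x => productCoeff α s (toProduct α x) ∈ A)
    ?_ (hA.preimage ((productCoeff α s).continuous.comp (continuous_toProduct α))) x
  intro y hy
  induction hy using Submodule.span_induction with
  | mem y hy =>
    obtain ⟨t, a, rfl⟩ := hy
    rw [homogeneousCLM_apply, toProduct_homogeneous, productCoeff_single]
    split_ifs
    · exact a.2
    · exact A.zero_mem
  | zero => rw [map_zero, map_zero]; exact A.zero_mem
  | add y z _ _ hy hz => rw [map_add, map_add]; exact A.add_mem hy hz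
  | smul c y _ hy => rw [map_smul, map_smul]; exact SMulMemClass.smul_mem c hy

/-- The Fourier coefficients of elements of the crossed product. -/
def fourierCoeff (hA : IsClosed (A : Set (H →L[ℂ] H))) (s : G) : crossedProduct α →L[ℂ] A where
  toFun x := ⟨productCoeff α s (toProduct α x), productCoeff_mem α hA s x⟩
  map_add' x y := Subtype.ext <| by
    change productCoeff α s (toProduct α (x + y)) =
      productCoeff α s (toProduct α x) + productCoeff α s (toProduct α y)
    rw [map_add, map_add]
  map_smul' c x := Subtype.ext <| by
    change productCoeff α s (toProduct α (c • x)) = c • productCoeff α s (toProduct α x)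
    rw [map_smul, map_smul]
  cont := ((productCoeff α s).continuous.comp (continuous_toProduct α)).subtype_mk _

end Gauge

/-! ### The crossed product as a Fourier system, and the theorem. -/

section Main

instance {E : Type*} [NonUnitalNormedRing E] [NormedSpace ℂ E] (S : NonUnitalSubalgebra ℂ E) :
    NormedSpace ℂ S where
  norm_smul_le c x := norm_smul_le c (x : E)

variable {H : Type u} [NormedAddCommGroup H] [InnerProductSpace ℂ H] [CompleteSpace H]
  {A : NonUnitalSubalgebra ℂ (H →L[ℂ] H)} {G : Type v} [CommGroup G] (α : Action G A)

/-- The crossed product by a commutative group with its Fourier coefficients and dual action. -/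
def crossedProductFourierSystem (hA : IsClosed (A : Set (H →L[ℂ] H))) :
    FourierSystem G A (crossedProduct α) where
  act s a := α.toFun s a
  act_one := α.map_one
  act_act_inv s a := by rw [← α.map_mul, mul_inv_cancel, α.map_one]
  ι := homogeneousCLM α
  ι_mul_ι := homogeneous_mul_homogeneous α
  dense := dense_span_homogeneous α
  coeff := fourierCoeff α hA
  coeff_ι_self s a := by
    classical
    exact Subtype.ext ((productCoeff_single α s s a).trans (if_pos rfl))
  coeff_ι_of_ne s t a h := by
    classical
    exact Subtype.ext ((productCoeff_single α s t a).trans (if_neg h))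
  gauge := gauge α
  norm_gauge_le χ x := by
    rw [← norm_toProduct, ← norm_toProduct, toProduct_gauge]
    exact NonUnitalStarAlgHom.norm_apply_le (gaugeHom χ) _
  gauge_ι χ s a := toProduct_injective α <| by
    rw [toProduct_gauge, map_smul]
    exact gaugeHom_universalIntegrated_single χ s (toCStarMax a)

lemma completeSpace_crossedProduct : CompleteSpace (crossedProduct α) :=
  (NonUnitalSubalgebra.isClosed_topologicalClosure _ : IsClosed
    (crossedProduct α : Set (CStarCrossedProduct (maxAction α)))).completeSpace_coe

end Main

end OpAlg

end

theorem mainTheorem7 {H : Type u} [NormedAddCommGroup H] [InnerProductSpace ℂ H] [CompleteSpace H]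
    (A : NonUnitalSubalgebra ℂ (H →L[ℂ] H)) (hA : OpAlg.IsOperatorAlgebra A)
    {G : Type v} [CommGroup G] (α : OpAlg.Action G A)
    (hss : OpAlg.IsSemisimple A) :
    OpAlg.IsSemisimple (OpAlg.crossedProduct α) := by
  have := OpAlg.completeSpace_crossedProduct α
  exact (OpAlg.crossedProductFourierSystem α hA.isClosed).isSemisimple hss
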